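/- **Theorem (trace semantics for finite acyclic KSC diagrams).** Let every object $X$ have an underlying standard Borel space $\underline X$, and let a finite ordered tuple (profile) $\mathbf X=(X_1,\dots,X_m)$, $m\ge 0$, have the underlying product space $\underline{\mathbf X}=\prod_{r=1}^m\underline{X_r}$ (one point if $m=0$). A *finite acyclic (uncolored) kernel-slotwise-composition (KSC) diagram* $D$ consists of: * a finite set $V$ of vertices, each $u\in V$ labelled by a Markov kernel $k_u:\underline{\mathbf A_u}\to\underline{\mathbf B_u}$, where $\mathbf A_u=(A_{u,1},\dots,A_{u,m_u})$ and $\mathbf B_u=(B_{u,1},\dots,B_{u,n_u})$ are profiles; * a finite set of internal wires $((u,p),(v,q))$, each connecting the $p$-th output slot of $u$ to the $q$-th input slot of $v$, with $B_{u,p}=A_{v,q}$, such that each input slot is the target of at most one wire, each output slot is the source of at most one wire, and the directed graph on $V$ with an edge $u\to v$ for every internal wire $((u,p),(v,q))$ has no directed cycle; * an ordered list, without repetition, of all external input slots (the input slots that are not targets of internal wires) and an ordered list, without repetition, of all external output slots (the output slots that are not sources of internal wires). These lists determine the external profiles $\mathbf I_D$ and $\mathbf O_D$. A *topological ordering* of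 $D$ is an enumeration $\sigma=(u_1,\dots,u_N)$ of $V$ in which every internal wire goes from an earlier to a later vertex. For an external input $\mathbf x\in\underline{\mathbf I_D}$, the *labelled joint trace law along $\sigma$* is the measure on $\prod_{u\in V}\underline{\mathbf B_u}$ $$\mu_D^\sigma(d(\mathbf y_u)_{u\in V}\mid\mathbf x)=k_{u_1}(d\mathbf y_{u_1}\mid\mathbf a_{u_1})\,k_{u_2}(d\mathbf y_{u_2}\mid\mathbf a_{u_2})\cdots k_{u_N}(d\mathbf y_{u_N}\mid\mathbf a_{u_N}),$$ where the local input $\mathbf a_{u_r}$ takes at each input slot that is the target of an internal wire the value in $(\mathbf y_{u_1},\dots,\mathbf y_{u_{r-1}})$ at the source of that wire, and at each external input slot the corresponding component of $\mathbf x$. Let $\pi_{\mathbf O_D}:\prod_{u\in V}\underline{\mathbf B_u}\to\underline{\mathbf O_D}$ be the projection to the external output slots in their given order. Then, for every finite acyclic KSC diagram $D$: 1. $D$ has a topological ordering. 2. There is a unique Markov kernel $\mu_D:\underline{\mathbf I_D}\to\prod_{u\in V}\underline{\mathbf B_u}$ with $\mu_D^\sigma=\mu_D$ for every topological ordering $\sigma$.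 That is, the labelled joint trace law is a Markov kernel and does not depend on the topological ordering. 3. There is a unique Markov kernel $K_D:\mathbf I_D\to\mathbf O_D$ such that, for every topological ordering $\sigma$, every $\mathbf x\in\underline{\mathbf I_D}$ and every measurable $E\subseteq\underline{\mathbf O_D}$, $$K_D(E\mid\mathbf x)=\int \mathbf 1_E\bigl(\pi_{\mathbf O_D}(\mathbf y)\bigr)\,\mu_D^\sigma(d\mathbf y\mid\mathbf x).$$ That is, the internal wires are integrated out, and $D$ determines a unique Markov kernel from its ordered external inputs to its ordered external outputs. -/

import Mathlib

open MeasureTheory ProbabilityTheory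

universe u v w

noncomputable section

/-- A finite ordered tuple (profile) of objects; the empty tuple is allowed. -/
structure Profile (Obj : Type u) where
  length : ℕ
  obj : Fin length → Obj

/-- The product space underlying a profile, where `S X` is the space underlying the object `X`.
It carries the product sigma-algebra; for the empty profile it is a one-point space. -/
abbrev Tuple {Obj : Type u} (S : Obj → Type v) (P : Profile Obj) : Type v :=
  ∀ i : Fin P.length, S (P.obj i)

/-- The identification of the spaces underlying two literally equal objects. -/
def transport {Obj : Type u} (S : Obj → Type v) {X Y : Obj} (h : X = Y) (a : S X) : S Y :=
  cast (congrArg S h) a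

theorem measurable_transport {Obj : Type u} (S : Obj → Type v) [∀ X, MeasurableSpace (S X)]
    {X Y : Obj} (h : X = Y) : Measurable (transport S h) := by
  subst h
  exact measurable_id

/-- A finite acyclic (uncolored) kernel-slotwise-composition diagram over the objects `Obj`, the
object `X` having the underlying measurable space `S X`. -/
structure KSCDiagram {Obj : Type u} (S : Obj → Type v) [∀ X, MeasurableSpace (S X)] where
  /-- The finite set of vertices. -/
  V : Type w
  [fintypeV : Fintype V]
  /-- The input profile of each vertex. -/
  inProfile : V → Profile Obj
  /-- The output profile of each vertex. -/
  outProfile : V → Profile Obj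
  /-- The Markov kernel labelling each vertex. -/
  kernel : ∀ u : V, Kernel (Tuple S (inProfile u)) (Tuple S (outProfile u))
  isMarkov : ∀ u : V, IsMarkovKernel (kernel u)
  /-- The internal wires: `((u, p), (v, q))` connects the output slot `p` of `u` to the input
  slot `q` of `v`. -/
  wires : Finset ((Σ u : V, Fin (outProfile u).length) × (Σ u : V, Fin (inProfile u).length))
  /-- Connected slots carry the same object. -/
  typed : ∀ e ∈ wires, (outProfile e.1.1).obj e.1.2 = (inProfile e.2.1).obj e.2.2
  /-- Each input slot is the target of at most one internal wire. -/
  linear_target : ∀ e ∈ wires, ∀ e' ∈ wires, e.2 = e'.2 → e = e'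
  /-- Each output slot is the source of at most one internal wire. -/
  linear_source : ∀ e ∈ wires, ∀ e' ∈ wires, e.1 = e'.1 → e = e'
  /-- The directed graph on the vertices given by the internal wires has no directed cycle. -/
  acyclic : ∀ u : V, ¬ Relation.TransGen
    (fun a b : V => ∃ e ∈ wires, e.1.1 = a ∧ e.2.1 = b) u u
  /-- The number of external inputs. -/
  numIn : ℕ
  /-- The ordered list, without repetition, of all external input slots: those that are not
  targets of internal wires. -/
  extIn : Fin numIn ≃ {s : Σ u : V, Fin (inProfile u).length // ¬ ∃ e ∈ wires, e.2 = s}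
  /-- The number of external outputs. -/
  numOut : ℕ
  /-- The ordered list, without repetition, of all external output slots: those that are not
  sources of internal wires. -/
  extOut : Fin numOut ≃ {s : Σ u : V, Fin (outProfile u).length // ¬ ∃ e ∈ wires, e.1 = s}

namespace KSCDiagram

attribute [instance] KSCDiagram.fintypeV KSCDiagram.isMarkov

variable {Obj : Type u} {S : Obj → Type v} [∀ X, MeasurableSpace (S X)]

/-- The ordered external input profile. -/
def inputProfile (D : KSCDiagram.{u, v, w} S) : Profile Obj where
  length := D.numIn
  obj i := (D.inProfile (D.extIn i).1.1).obj (D.extIn i).1.2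

/-- The ordered external output profile. -/
def outputProfile (D : KSCDiagram.{u, v, w} S) : Profile Obj where
  length := D.numOut
  obj i := (D.outProfile (D.extOut i).1.1).obj (D.extOut i).1.2

/-- The labelled product, over the vertices in `s`, of the output spaces of the vertices. -/
abbrev PartialTrace (D : KSCDiagram.{u, v, w} S) (s : Set D.V) : Type (max v w) :=
  ∀ u : s, Tuple S (D.outProfile u.1)

/-- The labelled product of the output spaces of all vertices. -/
abbrev Trace (D : KSCDiagram.{u, v, w} S) : Type (max v w) :=
  ∀ u : D.V, Tuple S (D.outProfile u)

/-- The input tuple of the vertex `a`, read off from the external input `x` and from the outputs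
of a set `s` of vertices that contains all sources of wires into `a`: a slot that is the target of
an internal wire receives the value on that wire, every other slot receives its external value. -/
def localInput (D : KSCDiagram.{u, v, w} S) (s : Set D.V) (a : D.V)
    (hs : ∀ e ∈ D.wires, e.2.1 = a → e.1.1 ∈ s)
    (xy : Tuple S D.inputProfile × D.PartialTrace s) : Tuple S (D.inProfile a) :=
  fun q =>
    open Classical in
    if h : ∃ e ∈ D.wires, e.2 = ⟨a, q⟩ then
      transport S
        ((D.typed h.choose h.choose_spec.1).trans
          (congrArg (fun t : Σ u : D.V, Fin (D.inProfile u).length => (D.inProfile t.1).obj t.2)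
            h.choose_spec.2))
        (xy.2 ⟨h.choose.1.1, hs h.choose h.choose_spec.1
          (congrArg Sigma.fst h.choose_spec.2)⟩ h.choose.1.2)
    else
      transport S
        (congrArg (fun t : {t : Σ u : D.V, Fin (D.inProfile u).length //
            ¬ ∃ e ∈ D.wires, e.2 = t} => (D.inProfile t.1.1).obj t.1.2)
          (D.extIn.apply_symm_apply ⟨⟨a, q⟩, h⟩))
        (xy.1 (D.extIn.symm ⟨⟨a, q⟩, h⟩))

theorem measurable_localInput (D : KSCDiagram.{u, v, w} S) (s : Set D.V) (a : D.V)
    (hs : ∀ e ∈ D.wires, e.2.1 = a → e.1.1 ∈ s) : Measurable (D.localInput s a hs) := by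
  refine measurable_pi_lambda _ fun q => ?_
  by_cases h : ∃ e ∈ D.wires, e.2 = ⟨a, q⟩
  · simp only [localInput, dif_pos h]
    exact (measurable_transport S _).comp
      ((measurable_pi_apply _).comp ((measurable_pi_apply _).comp measurable_snd))
  · simp only [localInput, dif_neg h]
    exact (measurable_transport S _).comp ((measurable_pi_apply _).comp measurable_fst)

/-- Adjoin an output of the vertex `a` to the outputs of the vertices in `s`, giving outputs of
the vertices in `t`, where every vertex of `t` other than `a` lies in `s`. -/
def extend (D : KSCDiagram.{u, v, w} S) (s t : Set D.V) (a : D.V)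
    (ht : ∀ u ∈ t, u ≠ a → u ∈ s)
    (yb : D.PartialTrace s × Tuple S (D.outProfile a)) : D.PartialTrace t :=
  fun u =>
    open Classical in
    if h : a = u.1 then h ▸ yb.2 else yb.1 ⟨u.1, ht u.1 u.2 (Ne.symm h)⟩

theorem measurable_extend (D : KSCDiagram.{u, v, w} S) (s t : Set D.V) (a : D.V)
    (ht : ∀ u ∈ t, u ≠ a → u ∈ s) : Measurable (D.extend s t a ht) := by
  refine measurable_pi_lambda _ fun u => ?_
  obtain ⟨u, hu⟩ := u
  by_cases h : a = u
  · subst h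
    simp only [extend, dif_pos]
    exact measurable_snd
  · simp only [extend, dif_neg h]
    exact (measurable_pi_apply _).comp measurable_fst

/-- One evaluation step: given the conditional law `μ` of the outputs of the vertices in `s`,
sample an output of the vertex `a` from its kernel at its local input, and adjoin it. -/
def step (D : KSCDiagram.{u, v, w} S) (s t : Set D.V) (a : D.V)
    (hs : ∀ e ∈ D.wires, e.2.1 = a → e.1.1 ∈ s) (ht : ∀ u ∈ t, u ≠ a → u ∈ s)
    (μ : Kernel (Tuple S D.inputProfile) (D.PartialTrace s)) :
    Kernel (Tuple S D.inputProfile) (D.PartialTrace t) :=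
  (μ.compProd ((D.kernel a).comap (D.localInput s a hs) (D.measurable_localInput s a hs))).map
    (D.extend s t a ht)

/-- A topological ordering of the vertices: an enumeration (`rank u` is the position of `u`) in
which every internal wire goes from an earlier to a later vertex. -/
structure TopologicalOrdering (D : KSCDiagram.{u, v, w} S) where
  rank : D.V ≃ Fin (Fintype.card D.V)
  mono : ∀ e ∈ D.wires, rank e.1.1 < rank e.2.1

/-- The conditional law, given the external input, of the outputs of the first `n` vertices of a
topological ordering, obtained by evaluating these vertices one after the other. -/
def traceUpTo (D : KSCDiagram.{u, v, w} S) (σ : D.TopologicalOrdering) :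
    (n : ℕ) → n ≤ Fintype.card D.V →
      Kernel (Tuple S D.inputProfile) (D.PartialTrace {u | (σ.rank u : ℕ) < n})
  | 0, _ => Kernel.deterministic
      (fun _ u => absurd u.2 (Nat.not_lt_zero _)) measurable_const
  | n + 1, hn =>
      D.step {u | (σ.rank u : ℕ) < n} {u | (σ.rank u : ℕ) < n + 1} (σ.rank.symm ⟨n, hn⟩)
        (fun e he h => by
          have := σ.mono e he
          rw [h, Equiv.apply_symm_apply] at this
          exact this)
        (fun u hu hne => by
          refine lt_of_le_of_ne (Nat.lt_succ_iff.mp hu) fun h => hne ?_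
          rw [Equiv.eq_symm_apply]
          exact Fin.ext h)
        (traceUpTo D σ n (Nat.le_of_succ_le hn))

/-- The labelled joint trace law along a topological ordering: the conditional law, given the
external input, of the outputs of all vertices, as a kernel into the labelled product. -/
def traceLaw (D : KSCDiagram.{u, v, w} S) (σ : D.TopologicalOrdering) :
    Kernel (Tuple S D.inputProfile) D.Trace :=
  (D.traceUpTo σ (Fintype.card D.V) le_rfl).map (fun y u => y ⟨u, (σ.rank u).2⟩)

/-- The ordered tuple of the values on the external output wires. -/
def outputProj (D : KSCDiagram.{u, v, w} S) (y : D.Trace) : Tuple S D.outputProfile :=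
  fun i => y (D.extOut i).1.1 (D.extOut i).1.2

end KSCDiagram

end

/-! Order independence is a diamond argument. Two vertices not wired to each other read inputs that
ignore each other's outputs, so sampling them in either order gives the same law by Tonelli
(`step_comm`). The claim is then generalised from full orderings to predecessor-closed vertex sets:
`IsLaw.unique` shows by induction on cardinality that such a set carries at most one evaluation law.
If two evaluations of `t` end at distinct vertices `a` and `a'`, both are compared with an
evaluation of `t` minus both vertices, followed by the two steps in either order. That common
evaluation exists by `exists_isLaw`.

Vertex sets are constrained by membership hypotheses instead of being written as `∅` or `insert a
s`, so rank segments and intersections fit without casts between dependent products. -/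

namespace KSCDiagram

variable {Obj : Type u} {S : Obj → Type v} [∀ X, MeasurableSpace (S X)]

/-! ### Topological orderings -/

/-- A finite acyclic diagram has a topological ordering. -/
theorem nonempty_topologicalOrdering (D : KSCDiagram.{u, v, w} S) :
    Nonempty D.TopologicalOrdering := by
  classical
  let r : D.V → D.V → Prop := fun a b => ∃ e ∈ D.wires, e.1.1 = a ∧ e.2.1 = b
  -- Reachability is antisymmetric exactly because there are no cycles; any linear extension of it
  -- then gives the ranks.
  let P : PartialOrder D.V :=
    { le := Relation.ReflTransGen r
      le_refl := fun _ => Relation.ReflTransGen.refl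
      le_trans := fun _ _ _ => Relation.ReflTransGen.trans
      le_antisymm := fun a b hab hba => by
        rcases Relation.reflTransGen_iff_eq_or_transGen.mp hab with h | h
        · exact h.symm
        · exact absurd (h.trans_left hba) (D.acyclic a) }
  let : Fintype (LinearExtension D.V) := D.fintypeV
  let f : LinearExtension D.V ≃o Fin (Fintype.card D.V) :=
    (Fintype.orderIsoFinOfCardEq (LinearExtension D.V) rfl).symm
  refine ⟨⟨f.toEquiv, fun e he => lt_of_le_of_ne ?_ fun h => ?_⟩⟩
  · exact f.monotone (toLinearExtension.monotone
      (Relation.ReflTransGen.single (⟨e, he, rfl, rfl⟩ : r e.1.1 e.2.1)))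
  · exact D.acyclic e.1.1 (.single ⟨e, he, rfl, (f.toEquiv.injective h).symm⟩)

/-! ### Evaluation steps and their commutation -/

/-- A step preserves Markov kernels. -/
theorem isMarkovKernel_step (D : KSCDiagram.{u, v, w} S) (s t : Set D.V) (a : D.V)
    (hs : ∀ e ∈ D.wires, e.2.1 = a → e.1.1 ∈ s) (ht : ∀ u ∈ t, u ≠ a → u ∈ s)
    (μ : Kernel (Tuple S D.inputProfile) (D.PartialTrace s)) [IsMarkovKernel μ] :
    IsMarkovKernel (D.step s t a hs ht μ) := by
  unfold step
  exact Kernel.IsMarkovKernel.map _ (D.measurable_extend s t a ht)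

/-- Integration against a step is iterated integration. -/
theorem lintegral_step (D : KSCDiagram.{u, v, w} S) (s t : Set D.V) (a : D.V)
    (hs : ∀ e ∈ D.wires, e.2.1 = a → e.1.1 ∈ s) (ht : ∀ u ∈ t, u ≠ a → u ∈ s)
    (μ : Kernel (Tuple S D.inputProfile) (D.PartialTrace s)) [IsMarkovKernel μ]
    (x : Tuple S D.inputProfile) {f : D.PartialTrace t → ENNReal} (hf : Measurable f) :
    ∫⁻ y, f y ∂(D.step s t a hs ht μ x) =
      ∫⁻ y, ∫⁻ b, f (D.extend s t a ht (y, b)) ∂(D.kernel a (D.localInput s a hs (x, y)))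
        ∂(μ x) := by
  have hm := D.measurable_extend s t a ht
  unfold step
  rw [Kernel.lintegral_map _ hm _ hf, Kernel.lintegral_compProd (f := fun p => f (D.extend s t a ht p)) _ _ _
    (hf.comp hm)]
  simp only [Kernel.comap_apply]

/-- The input of a vertex does not depend on the outputs of vertices that are not wired to it. -/
theorem localInput_extend (D : KSCDiagram.{u, v, w} S) (r s : Set D.V) (a a' : D.V)
    (hr : ∀ e ∈ D.wires, e.2.1 = a → e.1.1 ∈ r) (hs : ∀ e ∈ D.wires, e.2.1 = a → e.1.1 ∈ s)
    (hsr : ∀ u ∈ s, u ≠ a' → u ∈ r) (ha' : a' ∉ r)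
    (x : Tuple S D.inputProfile) (y : D.PartialTrace r) (b : Tuple S (D.outProfile a')) :
    D.localInput s a hs (x, D.extend r s a' hsr (y, b)) = D.localInput r a hr (x, y) := by
  funext q
  by_cases h : ∃ e ∈ D.wires, e.2 = ⟨a, q⟩
  · have hne : a' ≠ h.choose.1.1 := fun h' =>
      ha' (h' ▸ hr h.choose h.choose_spec.1 (congrArg Sigma.fst h.choose_spec.2))
    simp only [localInput, dif_pos h, extend, dif_neg hne]
  · simp only [localInput, dif_neg h]

/-- Adjoining the outputs of two distinct vertices does not depend on the order. -/
theorem extend_comm (D : KSCDiagram.{u, v, w} S) (r s s' t : Set D.V) (a a' : D.V)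
    (hne : a ≠ a') (hts : ∀ u ∈ t, u ≠ a → u ∈ s) (hsr : ∀ u ∈ s, u ≠ a' → u ∈ r)
    (hts' : ∀ u ∈ t, u ≠ a' → u ∈ s') (hsr' : ∀ u ∈ s', u ≠ a → u ∈ r)
    (y : D.PartialTrace r) (b : Tuple S (D.outProfile a)) (b' : Tuple S (D.outProfile a')) :
    D.extend s t a hts (D.extend r s a' hsr (y, b'), b) =
      D.extend s' t a' hts' (D.extend r s' a hsr' (y, b), b') := by
  funext ⟨u, hu⟩
  by_cases h : a = u
  · subst h
    simp [extend, hne.symm]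
  · by_cases h' : a' = u
    · subst h'
      simp [extend, hne]
    · simp [extend, h, h']

/-- Steps at two vertices, neither of which is wired to the other, commute. -/
theorem step_comm (D : KSCDiagram.{u, v, w} S) (r s s' t : Set D.V) (a a' : D.V)
    (hne : a ≠ a') (har : a ∉ r) (har' : a' ∉ r)
    (hr : ∀ e ∈ D.wires, e.2.1 = a → e.1.1 ∈ r) (hr' : ∀ e ∈ D.wires, e.2.1 = a' → e.1.1 ∈ r)
    (hs : ∀ e ∈ D.wires, e.2.1 = a → e.1.1 ∈ s) (hs' : ∀ e ∈ D.wires, e.2.1 = a' → e.1.1 ∈ s')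
    (hts : ∀ u ∈ t, u ≠ a → u ∈ s) (hsr : ∀ u ∈ s, u ≠ a' → u ∈ r)
    (hts' : ∀ u ∈ t, u ≠ a' → u ∈ s') (hsr' : ∀ u ∈ s', u ≠ a → u ∈ r)
    (μ : Kernel (Tuple S D.inputProfile) (D.PartialTrace r)) [IsMarkovKernel μ] :
    D.step s t a hs hts (D.step r s a' hr' hsr μ) =
      D.step s' t a' hs' hts' (D.step r s' a hr hsr' μ) := by
  have := D.isMarkovKernel_step r s a' hr' hsr μ
  have := D.isMarkovKernel_step r s' a hr hsr' μ
  -- The inner integral of a step is measurable in the outputs sampled before.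
  have key : ∀ (s : Set D.V) (a : D.V) (hs : ∀ e ∈ D.wires, e.2.1 = a → e.1.1 ∈ s)
      (hts : ∀ u ∈ t, u ≠ a → u ∈ s) (x : Tuple S D.inputProfile)
      (f : D.PartialTrace t → ENNReal), Measurable f →
      Measurable fun y => ∫⁻ b, f (D.extend s t a hts (y, b))
        ∂(D.kernel a (D.localInput s a hs (x, y))) := by
    intro s a hs hts x f hf
    have hm : Measurable fun y : D.PartialTrace s => D.localInput s a hs (x, y) :=
      (D.measurable_localInput s a hs).comp measurable_prodMk_left
    exact Measurable.lintegral_kernel_prod_right' (κ := (D.kernel a).comap _ hm)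
      (hf.comp (D.measurable_extend s t a hts))
  refine Kernel.ext_fun fun x f hf => ?_
  rw [lintegral_step _ _ _ _ _ _ _ _ hf, lintegral_step _ _ _ _ _ _ _ _ hf,
    lintegral_step _ _ _ _ _ _ _ _ (key s a hs hts x f hf),
    lintegral_step _ _ _ _ _ _ _ _ (key s' a' hs' hts' x f hf)]
  refine lintegral_congr fun y => ?_
  -- Both local inputs now depend only on `y`, so for fixed `y` the inner double integrals are
  -- against a product of two fixed measures.
  simp only [D.localInput_extend r s a a' hr hs hsr har',
    D.localInput_extend r s' a' a hr' hs' hsr' har,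
    D.extend_comm r s s' t a a' hne hts hsr hts' hsr']
  refine lintegral_lintegral_swap (Measurable.aemeasurable ?_)
  refine hf.comp ((D.measurable_extend s' t a' hts').comp (Measurable.prodMk ?_ measurable_fst))
  exact (D.measurable_extend r s' a hsr').comp (measurable_const.prodMk measurable_snd)

/-! ### Evaluation laws of predecessor-closed sets -/

/-- `D.IsLaw s μ` says that `μ` results from evaluating the vertices in `s`, one after the other,
each after all the vertices wired to it. -/
inductive IsLaw (D : KSCDiagram.{u, v, w} S) :
    (s : Set D.V) → Kernel (Tuple S D.inputProfile) (D.PartialTrace s) → Prop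
  | empty (s : Set D.V) (hs : ∀ u, u ∉ s) :
      IsLaw D s (Kernel.deterministic (fun _ u => absurd u.2 (hs u)) measurable_const)
  | step (s t : Set D.V) (a : D.V) (hs : ∀ e ∈ D.wires, e.2.1 = a → e.1.1 ∈ s)
      (ht : ∀ u ∈ t, u ≠ a → u ∈ s) (has : a ∉ s) (hat : a ∈ t) (hst : s ⊆ t)
      (μ : Kernel (Tuple S D.inputProfile) (D.PartialTrace s)) (hμ : IsLaw D s μ) :
      IsLaw D t (D.step s t a hs ht μ)

variable {D : KSCDiagram.{u, v, w} S}

theorem IsLaw.isMarkovKernel {s : Set D.V}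
    {μ : Kernel (Tuple S D.inputProfile) (D.PartialTrace s)} (h : D.IsLaw s μ) :
    IsMarkovKernel μ := by
  induction h with
  | empty s hs => infer_instance
  | step s t a hs ht has hat hst μ hμ ih => exact D.isMarkovKernel_step s t a hs ht μ

/-- Closure under predecessors passes to intersections, which is what makes `s ∩ s'` evaluable in
`IsLaw.unique`. -/
theorem IsLaw.source_mem {s : Set D.V}
    {μ : Kernel (Tuple S D.inputProfile) (D.PartialTrace s)} (h : D.IsLaw s μ) :
    ∀ e ∈ D.wires, e.2.1 ∈ s → e.1.1 ∈ s := by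
  induction h with
  | empty s hs => exact fun e _ h => absurd h (hs _)
  | step s t a hs ht has hat hst μ hμ ih =>
    intro e he h
    by_cases hea : e.2.1 = a
    · exact hst (hs e he hea)
    · exact hst (ih e he (ht _ h hea))

/-- Every set of vertices that is closed under predecessors can be evaluated. -/
theorem exists_isLaw (σ : D.TopologicalOrdering) (s : Set D.V)
    (hs : ∀ e ∈ D.wires, e.2.1 ∈ s → e.1.1 ∈ s) :
    ∃ μ : Kernel (Tuple S D.inputProfile) (D.PartialTrace s), D.IsLaw s μ := by
  induction hn : s.ncard generalizing s with
  | zero =>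
    have : s = ∅ := (Set.ncard_eq_zero s.toFinite).mp hn
    exact ⟨_, IsLaw.empty s fun u hu => by simp [this] at hu⟩
  | succ n ih =>
    have hne : s.Nonempty := Set.nonempty_of_ncard_ne_zero (by omega)
    -- A vertex of largest rank feeds no vertex of `s`, so removing it keeps `s` closed under
    -- predecessors.
    obtain ⟨a, ha, hmax⟩ := Set.exists_max_image s σ.rank s.toFinite hne
    have hcl : ∀ e ∈ D.wires, e.2.1 ∈ s → e.1.1 ∈ s \ {a} := fun e he h =>
      ⟨hs e he h, fun h' => absurd (hmax _ h) (not_le.mpr (h' ▸ σ.mono e he))⟩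
    obtain ⟨μ, hμ⟩ := ih (s \ {a}) (fun e he h => hcl e he h.1)
      (by rw [Set.ncard_sdiff_singleton_of_mem ha]; omega)
    exact ⟨_, IsLaw.step (s \ {a}) s a (fun e he h => hcl e he (h ▸ ha))
      (fun u hu hua => ⟨hu, hua⟩) (by simp) ha Set.sdiff_subset μ hμ⟩

/-- The law of the outputs of a set of vertices does not depend on the order of evaluation. -/
theorem IsLaw.unique {t : Set D.V}
    {μ μ' : Kernel (Tuple S D.inputProfile) (D.PartialTrace t)}
    (h : D.IsLaw t μ) (h' : D.IsLaw t μ') : μ = μ' := by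
  induction hn : t.ncard using Nat.strong_induction_on generalizing t with
  | _ n ih =>
  cases h with
  | empty _ hemp =>
    cases h' with
    | empty => rfl
    | step s' _ a' _ _ _ hat' => exact absurd hat' (hemp a')
  | step s _ a hs hts has hat hst κ hκ =>
    cases h' with
    | empty _ hemp => exact absurd hat (hemp a)
    | step s' _ a' hs' hts' has' hat' hst' κ' hκ' =>
      have hlt : s.ncard < n := hn ▸ Set.ncard_lt_ncard ⟨hst, fun h => has (h hat)⟩ t.toFinite
      have hlt' : s'.ncard < n :=
        hn ▸ Set.ncard_lt_ncard ⟨hst', fun h => has' (h hat')⟩ t.toFinite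
      by_cases hne : a = a'
      · subst hne
        -- With the same last vertex, both sets are `t \ {a}`.
        have hss : s = s' := by
          ext u
          exact ⟨fun h => hts' u (hst h) fun e => has (e ▸ h),
            fun h => hts u (hst' h) fun e => has' (e ▸ h)⟩
        subst hss
        rw [ih _ hlt hκ hκ' rfl]
      · have hs's : a' ∈ s := hts a' hat' (Ne.symm hne)
        have hss' : a ∈ s' := hts' a hat hne
        -- The bottom of the diamond: `s ∩ s'` is `t` without `a` and `a'`. The ordering `σ` serves
        -- only to produce a law on it.
        obtain ⟨σ⟩ := D.nonempty_topologicalOrdering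
        obtain ⟨ν, hν⟩ := exists_isLaw σ (s ∩ s') fun e he h =>
          ⟨hκ.source_mem e he h.1, hκ'.source_mem e he h.2⟩
        have hr : ∀ e ∈ D.wires, e.2.1 = a → e.1.1 ∈ s ∩ s' := fun e he h =>
          ⟨hs e he h, hκ'.source_mem e he (h ▸ hss')⟩
        have hr' : ∀ e ∈ D.wires, e.2.1 = a' → e.1.1 ∈ s ∩ s' := fun e he h =>
          ⟨hκ.source_mem e he (h ▸ hs's), hs' e he h⟩
        have hsr : ∀ u ∈ s, u ≠ a' → u ∈ s ∩ s' := fun u hu h => ⟨hu, hts' u (hst hu) h⟩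
        have hsr' : ∀ u ∈ s', u ≠ a → u ∈ s ∩ s' := fun u hu h => ⟨hts u (hst' hu) h, hu⟩
        have hκν := ih _ hlt hκ (IsLaw.step (s ∩ s') s a' hr' hsr (fun h => has' h.2) hs's
          Set.inter_subset_left ν hν) rfl
        have hκν' := ih _ hlt' hκ' (IsLaw.step (s ∩ s') s' a hr hsr' (fun h => has h.1) hss'
          Set.inter_subset_right ν hν) rfl
        have := hν.isMarkovKernel
        rw [hκν, hκν']
        exact D.step_comm (s ∩ s') s s' t a a' hne (fun h => has h.1) (fun h => has' h.2)
          hr hr' hs hs' hts hsr hts' hsr' ν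

/-! ### Trace laws and the induced kernel -/

theorem isLaw_traceUpTo (σ : D.TopologicalOrdering) (n : ℕ) (hn : n ≤ Fintype.card D.V) :
    D.IsLaw {u | (σ.rank u : ℕ) < n} (D.traceUpTo σ n hn) := by
  induction n with
  | zero =>
    rw [traceUpTo]
    exact IsLaw.empty {u | (σ.rank u : ℕ) < 0} fun u => Nat.not_lt_zero (σ.rank u)
  | succ n ih =>
    rw [traceUpTo]
    apply IsLaw.step
    · simp
    · simp
    · exact fun u hu => Nat.lt_succ_of_lt hu
    · exact ih (Nat.le_of_succ_le hn)

theorem isMarkovKernel_traceLaw (σ : D.TopologicalOrdering) : IsMarkovKernel (D.traceLaw σ) := by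
  have := (isLaw_traceUpTo σ _ le_rfl).isMarkovKernel
  exact Kernel.IsMarkovKernel.map _ (measurable_pi_lambda _ fun u => measurable_pi_apply _)

/-- The final rank segments of two orderings both contain every vertex but are different
expressions, so their laws have different types. With `s` and `s'` as variables, the equality of
sets can be substituted. -/
theorem IsLaw.map_eq_map {s s' : Set D.V}
    {μ : Kernel (Tuple S D.inputProfile) (D.PartialTrace s)}
    {μ' : Kernel (Tuple S D.inputProfile) (D.PartialTrace s')}
    (h : D.IsLaw s μ) (h' : D.IsLaw s' μ') (hs : ∀ u, u ∈ s) (hs' : ∀ u, u ∈ s') :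
    μ.map (fun y u => y ⟨u, hs u⟩ : D.PartialTrace s → D.Trace) =
      μ'.map (fun y u => y ⟨u, hs' u⟩ : D.PartialTrace s' → D.Trace) := by
  obtain rfl : s = s' := Set.ext fun u => iff_of_true (hs u) (hs' u)
  rw [h.unique h']

/-- The labelled joint trace law does not depend on the topological ordering. -/
theorem traceLaw_eq (σ τ : D.TopologicalOrdering) : D.traceLaw σ = D.traceLaw τ :=
  (isLaw_traceUpTo σ _ le_rfl).map_eq_map (isLaw_traceUpTo τ _ le_rfl)
    (fun u => (σ.rank u).2) (fun u => (τ.rank u).2)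

theorem measurable_outputProj (D : KSCDiagram.{u, v, w} S) : Measurable D.outputProj :=
  measurable_pi_lambda _ fun _ => (measurable_pi_apply _).comp (measurable_pi_apply _)

end KSCDiagram

theorem mainTheorem2 {Obj : Type u} (S : Obj → Type v) [∀ X, MeasurableSpace (S X)]
    [∀ X, StandardBorelSpace (S X)] (D : KSCDiagram.{u, v, w} S) :
    Nonempty D.TopologicalOrdering ∧
    (∃! μ : Kernel (Tuple S D.inputProfile) D.Trace,
      IsMarkovKernel μ ∧ ∀ σ : D.TopologicalOrdering, D.traceLaw σ = μ) ∧
    (∃! K : Kernel (Tuple S D.inputProfile) (Tuple S D.outputProfile),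
      IsMarkovKernel K ∧
      ∀ (σ : D.TopologicalOrdering) (x : Tuple S D.inputProfile)
        (E : Set (Tuple S D.outputProfile)), MeasurableSet E →
          K x E = ∫⁻ y, E.indicator 1 (D.outputProj y) ∂(D.traceLaw σ x)) := by
  -- Existence of an ordering is also what gives both uniqueness claims: without one, the conditions
  -- over all `σ` would be vacuous.
  obtain ⟨σ₀⟩ := D.nonempty_topologicalOrdering
  have := KSCDiagram.isMarkovKernel_traceLaw σ₀
  have hm := D.measurable_outputProj
  refine ⟨⟨σ₀⟩, ⟨D.traceLaw σ₀, ⟨this, fun σ => KSCDiagram.traceLaw_eq σ σ₀⟩,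
    fun μ hμ => (hμ.2 σ₀).symm⟩, ⟨(D.traceLaw σ₀).map D.outputProj,
    ⟨Kernel.IsMarkovKernel.map _ hm, fun σ x E hE => ?_⟩, fun K hK => ?_⟩⟩
  · rw [KSCDiagram.traceLaw_eq σ σ₀, Kernel.map_apply' _ hm _ hE,
      ← lintegral_indicator_one (hm hE)]
    rfl
  · refine Kernel.ext fun x => Measure.ext fun E hE => ?_
    rw [hK.2 σ₀ x E hE, Kernel.map_apply' _ hm _ hE, ← lintegral_indicator_one (hm hE)]
    rfl
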